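/- Let $H$ be a real Hilbert space, $\mu>0$, $n\ge 1$, and let $\lambda_1,\dots,\lambda_n>0$ with $\sum_{i=1}^n\lambda_i=1$. For a set-valued mapping $A:H\rightrightarrows H$ put $\operatorname{dom}A=\{x : Ax\neq\varnothing\}$, $\operatorname{ran}A=\bigcup_{x}Ax$, $\operatorname{gra}A=\{(x,u): u\in Ax\}$, and let $A^{-1}$ be given by $x\in A^{-1}u\Leftrightarrow u\in Ax$. $A$ is monotone if $\langle x-y,u-v\rangle\ge 0$ for all $(x,u),(y,v)\in\operatorname{gra}A$, and maximally monotone if it is monotone and $\operatorname{gra}A$ is not a proper subset of the graph of a monotone mapping. For $\mathbf A=(A_1,\dots,A_n)$ with $A_i:H\rightrightarrows H$ and $\boldsymbol\lambda=(\lambda_1,\dots,\lambda_n)$, the resolvent average is $$\mathcal R_\mu(\mathbf A,\boldsymbol\lambda)=\Big(\sum_{i=1}^n\lambda_i\,(A_i+\mu^{-1}\mathrm{Id})^{-1}\Big)^{-1}-\mu^{-1}\mathrm{Id}.$$ Sums, differences and scalar multiples of sets, and (pointwise) of set-valued mappings, are those of Minkowski. The relative interior of $C\subseteq H$ is the interior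 of $C$ as a subset of its closed affine hull, and $C\simeq D$ ($C$ and $D$ are nearly equal) means that $C$ and $D$ have the same closure and the same relative interior. **Theorem.** If $A_1,\dots,A_n$ are maximally monotone, then $$\operatorname{ran}\mathcal R_\mu(\mathbf A,\boldsymbol\lambda)\simeq\sum_{i=1}^n\lambda_i\operatorname{ran}A_i,\qquad \operatorname{dom}\mathcal R_\mu(\mathbf A,\boldsymbol\lambda)\simeq\sum_{i=1}^n\lambda_i\operatorname{dom}A_i.$$ Neither near equality can be replaced by an equality, even for $H=\mathbb R^2$, $\mu=1$, $n=2$ and $A_1=A_2$: there is a maximally monotone $A:\mathbb R^2\rightrightarrows\mathbb R^2$ such that $\operatorname{dom}\mathcal R_1((A,A),(\lambda,1-\lambda))\neq\lambda\operatorname{dom}A+(1-\lambda)\operatorname{dom}A$ for every $\lambda\in\,]0,1[$, and there is a maximally monotone $A:\mathbb R^2\rightrightarrows\mathbb R^2$ such that $\operatorname{ran}\mathcal R_1((A,A),(\lambda,1-\lambda))\neq\lambda\operatorname{ran}A+(1-\lambda)\operatorname{ran}A$ for every $\lambda\in\,]0,1[$. -/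

import Mathlib

open scoped Pointwise

namespace ResolventAverage

section Operators

variable {H : Type*}

/-- The domain of a set-valued mapping `A : H ⇉ H`. -/
def dom (A : H → Set H) : Set H := {x | (A x).Nonempty}

/-- The range of a set-valued mapping. -/
def ran (A : H → Set H) : Set H := ⋃ x, A x

/-- The graph of a set-valued mapping. -/
def gra (A : H → Set H) : Set (H × H) := {p | p.2 ∈ A p.1}

/-- The inverse of a set-valued mapping. -/
def inv (A : H → Set H) : H → Set H := fun u => {x | u ∈ A x}

/-- The identity, as a set-valued mapping. -/
def idMap : H → Set H := fun x => {x}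

end Operators

section Monotone

variable {H : Type*} [NormedAddCommGroup H] [InnerProductSpace ℝ H]

/-- Monotonicity of a set-valued mapping. -/
def IsMonotone (A : H → Set H) : Prop :=
  ∀ p ∈ gra A, ∀ q ∈ gra A, 0 ≤ inner ℝ (p.1 - q.1) (p.2 - q.2)

/-- Maximal monotonicity: `A` is monotone and its graph is not a proper subset of the graph of
a monotone mapping. -/
def IsMaximallyMonotone (A : H → Set H) : Prop :=
  IsMonotone A ∧ ¬ ∃ B : H → Set H, IsMonotone B ∧ gra A ⊂ gra B

/-- The `w`-weighted resolvent average of `A` with parameter `μ`,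
`(∑ i, w i (A i + μ⁻¹ Id)⁻¹)⁻¹ - μ⁻¹ Id`. Sums, differences and scalar multiples of set-valued
mappings are taken pointwise, in the sense of Minkowski:
`(A + B) x = {u + v | u ∈ A x, v ∈ B x}` and `(c • A) x = {c • u | u ∈ A x}`. -/
noncomputable def resolventAverage {n : ℕ} (μ : ℝ) (A : Fin n → H → Set H) (w : Fin n → ℝ) :
    H → Set H :=
  inv (∑ i, w i • inv (A i + μ⁻¹ • idMap)) - μ⁻¹ • idMap

/-- The relative interior of `C`: the interior of `C` as a subset of its closed affine hull. -/
def relInterior (C : Set H) : Set H :=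
  (Subtype.val : closure (affineSpan ℝ C : Set H) → H) '' interior (Subtype.val ⁻¹' C)

/-- Two sets are nearly equal if they have the same closure and the same relative interior. -/
def NearlyEqual (C D : Set H) : Prop :=
  closure C = closure D ∧ relInterior C = relInterior D

end Monotone

end ResolventAverage

/-! By Minty's theorem each `(A i + μ⁻¹ Id)⁻¹` is a mapping `T i` defined on all of `H`. The domain
of the resolvent average is the range of `∑ w i • T i`, and its range is that of `∑ w i • (Id - μ⁻¹
• T i)`, while `T i` and `Id - μ⁻¹ • T i` have ranges `dom (A i)` and `ran (A i)`. Both families are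
cocoercive, so `nearlyEqual_range_sum` gives both near equalities.

That lemma is a Brezis–Haraux argument (`nearlyEqual_range`): solve `S z + ε z = d` and let `ε → 0`.
For `d` in the sum of the ranges, `ε z → 0`, so `d` is in the closure of the range. For `d` in the
relative interior, Banach–Steinhaus bounds `z`, and a bounded Tikhonov curve converges to a solution
of `S x = d`.

For equal mappings the average has the domain and range of `A`, so the counterexamples only need a
nonconvex domain or range. -/

namespace ResolventAverage

open Filter Topology

/-! ### Proximal points in a Hilbert space -/

section Minimization

variable {K : Type*} [NormedAddCommGroup K] [InnerProductSpace ℝ K]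

/-- The proximal point of a closed convex epigraph: `t + ‖x - z‖² / 2` attains its minimum over a
closed convex set of pairs `(x, t)` on which it is bounded below. The minimizer is described by
its variational inequality. -/
theorem exists_proximal_point [CompleteSpace K] {E : Set (K × ℝ)} (hconv : Convex ℝ E)
    (hclosed : IsClosed E) (hne : E.Nonempty) (z : K) {c : ℝ}
    (hc : ∀ p ∈ E, c ≤ p.2 + ‖p.1 - z‖ ^ 2 / 2) :
    ∃ p ∈ E, ∀ q ∈ E, p.2 + inner ℝ (z - p.1) (q.1 - p.1) ≤ q.2 := by
  set g : K × ℝ → ℝ := fun p => p.2 + ‖p.1 - z‖ ^ 2 / 2 with hg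
  have hbdd : BddBelow (g '' E) := ⟨c, by rintro _ ⟨p, hp, rfl⟩; exact hc p hp⟩
  set m := sInf (g '' E) with hm
  have hmle : ∀ p ∈ E, m ≤ g p := fun p hp => csInf_le hbdd ⟨p, hp, rfl⟩
  have hex : ∀ k : ℕ, ∃ p ∈ E, g p < m + 1 / ((k : ℝ) + 1) := by
    intro k
    obtain ⟨_, ⟨p, hp, rfl⟩, hlt⟩ := exists_lt_of_csInf_lt (hne.image g)
      (show sInf (g '' E) < m + 1 / ((k : ℝ) + 1) by
        have : 0 < 1 / ((k : ℝ) + 1) := by positivity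
        linarith)
    exact ⟨p, hp, hlt⟩
  choose p hpE hp using hex
  -- Strong convexity of `g`, read off at the midpoint, makes the first components of a minimizing
  -- sequence Cauchy.
  have hpar : ∀ a ∈ E, ∀ b ∈ E, ‖a.1 - b.1‖ ^ 2 ≤ 4 * (g a - m) + 4 * (g b - m) := by
    intro a ha b hb
    have hmid := hmle _ (hconv ha hb (by norm_num : (0 : ℝ) ≤ 1 / 2)
      (by norm_num : (0 : ℝ) ≤ 1 / 2) (by norm_num))
    have e1 := parallelogram_law_with_norm ℝ (a.1 - z) (b.1 - z)
    have e2 : ((1 / 2 : ℝ) • a + (1 / 2 : ℝ) • b).1 - z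
        = (1 / 2 : ℝ) • ((a.1 - z) + (b.1 - z)) := by
      simp only [Prod.fst_add, Prod.smul_fst]
      module
    have e3 : a.1 - z - (b.1 - z) = a.1 - b.1 := by abel
    simp only [hg] at hmid ⊢
    rw [e2, norm_smul] at hmid
    rw [e3] at e1
    simp only [Prod.snd_add, Prod.smul_snd, smul_eq_mul] at hmid
    norm_num at hmid
    nlinarith
  have hinv : Tendsto (fun k : ℕ => 1 / ((k : ℝ) + 1)) atTop (𝓝 0) :=
    tendsto_one_div_add_atTop_nhds_zero_nat
  have hcau : CauchySeq fun k => (p k).1 := by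
    refine cauchySeq_of_le_tendsto_0 (fun N : ℕ => √(8 * (1 / ((N : ℝ) + 1)))) ?_ ?_
    · intro k l N hk hl
      rw [dist_eq_norm]
      apply Real.le_sqrt_of_sq_le
      have h1 := hpar _ (hpE k) _ (hpE l)
      have h2 := hp k
      have h3 := hp l
      have h4 : 1 / ((k : ℝ) + 1) ≤ 1 / ((N : ℝ) + 1) := Nat.one_div_le_one_div hk
      have h5 : 1 / ((l : ℝ) + 1) ≤ 1 / ((N : ℝ) + 1) := Nat.one_div_le_one_div hl
      linarith
    · have := (hinv.const_mul 8).sqrt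
      simpa using this
  obtain ⟨x, hx⟩ := cauchySeq_tendsto_of_complete hcau
  have hgm : Tendsto (fun k => g (p k)) atTop (𝓝 m) := by
    refine tendsto_of_tendsto_of_tendsto_of_le_of_le tendsto_const_nhds
      (by simpa using hinv.const_add m) (fun k => hmle _ (hpE k)) (fun k => (hp k).le)
  have ht : Tendsto (fun k => (p k).2) atTop (𝓝 (m - ‖x - z‖ ^ 2 / 2)) := by
    have := hgm.sub ((((hx.sub_const z).norm).pow 2).div_const 2)
    refine this.congr fun k => ?_
    simp [hg]
  have hmem : (x, m - ‖x - z‖ ^ 2 / 2) ∈ E :=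
    hclosed.mem_of_tendsto (hx.prodMk_nhds ht) (Eventually.of_forall hpE)
  refine ⟨_, hmem, fun q hq => ?_⟩
  set t := m - ‖x - z‖ ^ 2 / 2 with ht'
  -- Compare the minimizer with a point of the segment towards `q` and divide by `s`; the limit `s →
  -- 0` removes the quadratic term.
  have hseg : ∀ s : ℝ, 0 < s → s ≤ 1 →
      t + inner ℝ (z - x) (q.1 - x) ≤ q.2 + s * (‖q.1 - x‖ ^ 2 / 2) := by
    intro s hs hs1
    have h := hmle _ (hconv hmem hq (sub_nonneg.2 hs1) hs.le (by ring))
    have e : ((1 - s) • (x, t) + s • q).1 - z = (x - z) + s • (q.1 - x) := by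
      simp only [Prod.fst_add, Prod.smul_fst]
      module
    simp only [hg] at h
    rw [e, norm_add_sq_real, inner_smul_right, norm_smul, Real.norm_of_nonneg hs.le] at h
    simp only [Prod.snd_add, Prod.smul_snd, smul_eq_mul] at h
    have e2 : inner ℝ (x - z) (q.1 - x) = - inner ℝ (z - x) (q.1 - x) := by
      rw [← inner_neg_left, neg_sub]
    rw [e2] at h
    have h' : 0 ≤ s * (q.2 + s * (‖q.1 - x‖ ^ 2 / 2) - (t + inner ℝ (z - x) (q.1 - x))) := by
      nlinarith
    have := nonneg_of_mul_nonneg_right h' hs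
    linarith
  have hlim : Tendsto (fun s : ℝ => q.2 + s * (‖q.1 - x‖ ^ 2 / 2)) (𝓝[>] 0) (𝓝 q.2) := by
    have : Tendsto (fun s : ℝ => q.2 + s * (‖q.1 - x‖ ^ 2 / 2)) (𝓝 0)
        (𝓝 (q.2 + 0 * (‖q.1 - x‖ ^ 2 / 2))) := (by fun_prop : Continuous _).tendsto 0
    simpa using this.mono_left nhdsWithin_le_nhds
  refine ge_of_tendsto hlim ?_
  filter_upwards [Ioc_mem_nhdsGT (zero_lt_one' ℝ)] with s hs using hseg s hs.1 hs.2

end Minimization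

/-! ### Maximal monotonicity and Minty's theorem -/

section Minty

variable {H : Type*} [NormedAddCommGroup H] [InnerProductSpace ℝ H]

theorem IsMonotone.inner_nonneg {A : H → Set H} (hA : IsMonotone A) {x u y v : H}
    (hu : u ∈ A x) (hv : v ∈ A y) : 0 ≤ inner ℝ (x - y) (u - v) :=
  hA (x, u) hu (y, v) hv

/-- A maximally monotone mapping contains every pair that is monotonically related to it. -/
theorem IsMaximallyMonotone.mem_of_related {A : H → Set H} (hA : IsMaximallyMonotone A) {x u : H}
    (h : ∀ y v, v ∈ A y → 0 ≤ inner ℝ (x - y) (u - v)) : u ∈ A x := by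
  by_contra hu
  refine hA.2 ⟨fun y => {v | v ∈ A y ∨ (y = x ∧ v = u)}, ?_, ?_, ?_⟩
  · rintro ⟨y, v⟩ hv ⟨y', v'⟩ hv'
    rcases hv with hv | ⟨hy, hv⟩ <;> rcases hv' with hv' | ⟨hy', hv'⟩ <;> dsimp only at *
    · exact hA.1.inner_nonneg hv hv'
    · subst hy' hv'
      rw [← neg_sub y' y, ← neg_sub v' v, inner_neg_neg]
      exact h _ _ hv
    · subst hy hv
      exact h _ _ hv'
    · subst hy hv hy' hv'
      simp
  · exact fun p hp => Or.inl hp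
  · exact fun hsub => hu (hsub (show (x, u) ∈ _ from Or.inr ⟨rfl, rfl⟩))

theorem isMaximallyMonotone_of_mem_of_related {A : H → Set H} (hA : IsMonotone A)
    (h : ∀ x u, (∀ y v, v ∈ A y → 0 ≤ inner ℝ (x - y) (u - v)) → u ∈ A x) :
    IsMaximallyMonotone A := by
  refine ⟨hA, ?_⟩
  rintro ⟨B, hB, hsub⟩
  exact hsub.2 fun p hp => h p.1 p.2 fun y v hv => hB p hp (y, v) (hsub.1 hv)

/-- The easy half of Minty's theorem. -/
theorem isMaximallyMonotone_of_surjective {A : H → Set H} (hA : IsMonotone A)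
    (h : ∀ z, ∃ x, z - x ∈ A x) : IsMaximallyMonotone A := by
  refine isMaximallyMonotone_of_mem_of_related hA fun x u hxu => ?_
  obtain ⟨y, hy⟩ := h (x + u)
  have h1 := hxu _ _ hy
  have e : u - (x + u - y) = -(x - y) := by abel
  rw [e, inner_neg_right, real_inner_self_eq_norm_sq] at h1
  have h2 : x - y = 0 := by
    rw [← norm_eq_zero]
    nlinarith [norm_nonneg (x - y)]
  obtain rfl := sub_eq_zero.1 h2
  simpa using hy

theorem IsMaximallyMonotone.inv {A : H → Set H} (hA : IsMaximallyMonotone A) :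
    IsMaximallyMonotone (inv A) := by
  refine isMaximallyMonotone_of_mem_of_related ?_ fun x u h => hA.mem_of_related fun y v hv => ?_
  · intro p hp q hq
    rw [real_inner_comm]
    exact hA.1.inner_nonneg hp hq
  · rw [real_inner_comm]
    exact h v y hv

/-- A continuous monotone single-valued mapping is maximally monotone. -/
theorem isMaximallyMonotone_singleton {S : H → H} (hS : Continuous S)
    (hmono : ∀ x y, 0 ≤ inner ℝ (x - y) (S x - S y)) :
    IsMaximallyMonotone fun x => ({S x} : Set H) := by
  refine isMaximallyMonotone_of_mem_of_related ?_ fun x u h => ?_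
  · rintro ⟨x, u⟩ hu ⟨y, v⟩ hv
    obtain rfl : u = S x := hu
    obtain rfl : v = S y := hv
    exact hmono x y
  · have key : ∀ s : ℝ, 0 < s → 0 ≤ inner ℝ (S x - u) (u - S (x - s • (S x - u))) := by
      intro s hs
      have := h (x - s • (S x - u)) _ rfl
      rw [sub_sub_cancel, real_inner_smul_left] at this
      exact nonneg_of_mul_nonneg_right this hs
    have hlim : Tendsto (fun s : ℝ => inner ℝ (S x - u) (u - S (x - s • (S x - u)))) (𝓝[>] 0)
        (𝓝 (inner ℝ (S x - u) (u - S x))) := by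
      have : Continuous fun s : ℝ => inner ℝ (S x - u) (u - S (x - s • (S x - u))) := by
        fun_prop
      simpa using (this.tendsto 0).mono_left nhdsWithin_le_nhds
    have h0 := ge_of_tendsto hlim (by
      filter_upwards [self_mem_nhdsWithin] with s hs using key s hs)
    rw [← neg_sub (S x) u, inner_neg_right, real_inner_self_eq_norm_sq] at h0
    have : S x - u = 0 := by
      rw [← norm_eq_zero]
      nlinarith [norm_nonneg (S x - u)]
    exact (sub_eq_zero.1 this).symm

/-- Minty's theorem at the origin, by minimization of the Fitzpatrick function. -/
theorem exists_neg_mem [CompleteSpace H] {G : Set (H × H)}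
    (hmono : ∀ p ∈ G, ∀ q ∈ G, 0 ≤ inner ℝ (p.1 - q.1) (p.2 - q.2))
    (hmax : ∀ p, (∀ q ∈ G, 0 ≤ inner ℝ (p.1 - q.1) (p.2 - q.2)) → p ∈ G) :
    ∃ x, (x, -x) ∈ G := by
  -- `E` is the epigraph of the Fitzpatrick function. It lies above the pairing by maximality
  -- (`hlow`) and meets it on `G` by monotonicity (`hdiag`). `WithLp 2` makes the product a Hilbert
  -- space.
  set E : Set (WithLp 2 (H × H) × ℝ) :=
    {p | ∀ q ∈ G, inner ℝ p.1.fst q.2 + inner ℝ q.1 p.1.snd - inner ℝ q.1 q.2 ≤ p.2} with hE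
  have hexp : ∀ p q : H × H, inner ℝ (p.1 - q.1) (p.2 - q.2)
      = inner ℝ p.1 p.2 - (inner ℝ p.1 q.2 + inner ℝ q.1 p.2 - inner ℝ q.1 q.2) := by
    intro p q
    simp only [inner_sub_left, inner_sub_right]
    ring
  have hdiag : ∀ q ∈ G, (WithLp.toLp 2 q, inner ℝ q.1 q.2) ∈ E := by
    intro q hq r hr
    have := hmono q hq r hr
    rw [hexp] at this
    exact sub_nonneg.1 this
  have hlow : ∀ p ∈ E, inner ℝ p.1.fst p.1.snd ≤ p.2 := by
    intro p hp
    by_contra! hlt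
    have hG : (p.1.fst, p.1.snd) ∈ G := hmax _ fun q hq => by
      rw [hexp]
      have := hp q hq
      dsimp only
      linarith
    have := hp _ hG
    dsimp only at this
    linarith
  have hconv : Convex ℝ E := by
    intro p hp p' hp' a b ha hb hab q hq
    have h1 := mul_le_mul_of_nonneg_left (hp q hq) ha
    have h2 := mul_le_mul_of_nonneg_left (hp' q hq) hb
    have h3 : inner ℝ q.1 q.2 = a * inner ℝ q.1 q.2 + b * inner ℝ q.1 q.2 := by
      rw [← add_mul, hab, one_mul]
    simp only [Prod.fst_add, Prod.smul_fst, Prod.snd_add, Prod.smul_snd, WithLp.add_fst,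
      WithLp.add_snd, WithLp.smul_fst, WithLp.smul_snd, inner_add_left, inner_add_right,
      real_inner_smul_left, real_inner_smul_right, smul_eq_mul]
    linarith
  have hclosed : IsClosed E := by
    simp only [hE, Set.ofPred_forall]
    refine isClosed_biInter fun q _ => isClosed_le ?_ ?_ <;> fun_prop
  have hne : E.Nonempty := by
    by_cases h : G.Nonempty
    · obtain ⟨q, hq⟩ := h
      exact ⟨_, hdiag q hq⟩
    · rw [Set.not_nonempty_iff_eq_empty] at h
      exact absurd (hmax 0 (by simp [h])) (by simp [h])
  obtain ⟨⟨p, t⟩, hp, hmin⟩ := exists_proximal_point hconv hclosed hne 0 (c := 0) (by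
    intro p hp
    have h1 := hlow p hp
    have h2 := norm_add_sq_real p.1.fst p.1.snd
    rw [sub_zero, WithLp.prod_norm_sq_eq_of_L2]
    nlinarith [sq_nonneg ‖p.1.fst + p.1.snd‖])
  have hlt := hlow _ hp
  dsimp only at hlt hmin
  -- The variational inequality at points of `G` shows that `(-p.snd, -p.fst)` is related to `G`
  -- with a surplus; testing this pair against itself forces the surplus to vanish.
  have key : ∀ q ∈ G, ‖p.fst + p.snd‖ ^ 2 ≤ inner ℝ (-p.snd - q.1) (-p.fst - q.2) := by
    intro q hq
    have := hmin _ (hdiag q hq)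
    simp only [WithLp.prod_inner_apply, zero_sub, inner_sub_right, inner_neg_left,
      real_inner_self_eq_norm_sq] at this
    change t + (-(inner ℝ p.fst q.1 + inner ℝ p.snd q.2) - -(‖p.fst‖ ^ 2 + ‖p.snd‖ ^ 2)) ≤ _ at this
    rw [norm_add_sq_real]
    simp only [inner_sub_left, inner_sub_right, inner_neg_left, inner_neg_right]
    rw [real_inner_comm p.fst p.snd, real_inner_comm p.fst q.1]
    linarith
  have hmem : (-p.snd, -p.fst) ∈ G := hmax _ fun q hq => (sq_nonneg _).trans (key q hq)
  have h0 := key _ hmem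
  simp only [sub_self, inner_zero_left] at h0
  have : p.fst + p.snd = 0 := by
    rw [← norm_eq_zero]
    nlinarith [norm_nonneg (p.fst + p.snd)]
  have e : -p.fst = p.snd := neg_eq_of_add_eq_zero_right this
  rw [e] at hmem
  exact ⟨-p.snd, by rwa [neg_neg]⟩

/-- Minty's theorem. -/
theorem IsMaximallyMonotone.exists_sub_smul_mem [CompleteSpace H] {A : H → Set H}
    (hA : IsMaximallyMonotone A) {c : ℝ} (hc : 0 < c) (z : H) : ∃ x, z - c • x ∈ A x := by
  suffices h : ∃ x, (x, -x) ∈ {p : H × H | z + c • p.2 ∈ A p.1} by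
    obtain ⟨x, hx⟩ := h
    refine ⟨x, ?_⟩
    rw [sub_eq_add_neg, ← smul_neg]
    exact hx
  apply exists_neg_mem
  · intro p hp q hq
    have := hA.1.inner_nonneg hp hq
    rw [add_sub_add_left_eq_sub, ← smul_sub, real_inner_smul_right] at this
    exact nonneg_of_mul_nonneg_right this hc
  · intro p hp
    refine hA.mem_of_related fun y v hv => ?_
    have := mul_nonneg hc.le (hp (y, c⁻¹ • (v - z)) (by simpa [smul_smul, hc.ne'] using hv))
    have e : z + c • p.2 - v = c • (p.2 - c⁻¹ • (v - z)) := by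
      rw [smul_sub, smul_smul, mul_inv_cancel₀ hc.ne', one_smul]
      abel
    rwa [e, real_inner_smul_right]

end Minty

/-! ### Relative interiors and near equality -/

section NearEquality

variable {H : Type*} [NormedAddCommGroup H] [InnerProductSpace ℝ H]

theorem mem_relInterior_iff {C : Set H} {x : H} :
    x ∈ relInterior C ↔ x ∈ closure (affineSpan ℝ C : Set H) ∧
      ∃ r > 0, ∀ y ∈ closure (affineSpan ℝ C : Set H), dist y x < r → y ∈ C := by
  simp only [relInterior, Set.mem_image, mem_interior_iff_mem_nhds, Metric.mem_nhds_iff]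
  constructor
  · rintro ⟨x, ⟨r, hr, h⟩, rfl⟩
    exact ⟨x.2, r, hr, fun y hy hxy => h (a := ⟨y, hy⟩) hxy⟩
  · rintro ⟨hx, r, hr, h⟩
    exact ⟨⟨x, hx⟩, ⟨r, hr, fun y hy => h y y.2 hy⟩, rfl⟩

/-- The closure of an affine subspace is again an affine subspace, here `Q`, and it contains
`closure C`, hence `D`. -/
theorem closure_affineSpan_eq_of_subset {C D : Set H} (hCD : C ⊆ D) (hDC : D ⊆ closure C) :
    closure (affineSpan ℝ C : Set H) = closure (affineSpan ℝ D : Set H) := by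
  refine (closure_mono (affineSpan_mono ℝ hCD)).antisymm
    (closure_minimal ?_ isClosed_closure)
  have h : ∀ c : ℝ, ∀ x ∈ closure (affineSpan ℝ C : Set H),
      ∀ y ∈ closure (affineSpan ℝ C : Set H), ∀ z ∈ closure (affineSpan ℝ C : Set H),
      c • (x - y) + z ∈ closure (affineSpan ℝ C : Set H) := by
    intro c x hx y hy z hz
    have h1 : c • (x - y) ∈ closure ((affineSpan ℝ C).direction : Set H) :=
      map_mem_closure₂ (f := fun x y => c • (x - y)) (by fun_prop) hx hy fun a ha b hb =>
        Submodule.smul_mem _ c (AffineSubspace.vsub_mem_direction ha hb)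
    exact map_mem_closure₂ (f := fun v z => v + z) (by fun_prop) h1 hz fun v hv a ha =>
      AffineSubspace.vadd_mem_of_mem_direction hv ha
  let Q : AffineSubspace ℝ H :=
    { carrier := closure (affineSpan ℝ C : Set H)
      smul_vsub_vadd_mem' := fun c {x y z} hx hy hz => h c x hx y hy z hz }
  have hQ : affineSpan ℝ D ≤ Q :=
    affineSpan_le.2 (hDC.trans (closure_mono (subset_affineSpan ℝ C)))
  exact hQ

/-- A set `D` squeezed between `C` and its closure is nearly equal to `C` as soon as its relative
interior lies in `C`. -/
theorem nearlyEqual_of_subset {C D : Set H} (hCD : C ⊆ D) (hDC : D ⊆ closure C)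
    (hint : relInterior D ⊆ C) : NearlyEqual C D := by
  have haff := closure_affineSpan_eq_of_subset hCD hDC
  refine ⟨(closure_mono hCD).antisymm (closure_minimal hDC isClosed_closure), ?_⟩
  ext x
  constructor
  · intro hx
    rw [mem_relInterior_iff] at hx ⊢
    rw [← haff]
    obtain ⟨hx, r, hr, h⟩ := hx
    exact ⟨hx, r, hr, fun y hy hyx => hCD (h y hy hyx)⟩
  · intro hx
    rw [mem_relInterior_iff] at hx
    rw [mem_relInterior_iff, haff]
    obtain ⟨hx, r, hr, h⟩ := hx
    refine ⟨hx, r, hr, fun y hy hyx => hint ?_⟩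
    rw [mem_relInterior_iff]
    refine ⟨hy, r - dist y x, sub_pos.2 hyx, fun z hz hzy => h z hz ?_⟩
    linarith [dist_triangle z y x]

end NearEquality

/-! ### The Brezis–Haraux argument -/

section BrezisHaraux

variable {H : Type*} [NormedAddCommGroup H] [InnerProductSpace ℝ H]

/-- A family in a subspace that is weakly bounded from above on a ball of the closure of the
subspace is bounded in norm. -/
theorem exists_norm_le_of_inner_le [CompleteSpace H] {ι : Type*} {W : Submodule ℝ H} {z : ι → H}
    (hz : ∀ k, z k ∈ W) {r : ℝ} (hr : 0 < r)
    (h : ∀ v ∈ W.topologicalClosure, ‖v‖ < r → ∃ c, ∀ k, inner ℝ (z k) v ≤ c) :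
    ∃ M, ∀ k, ‖z k‖ ≤ M := by
  have : CompleteSpace W.topologicalClosure :=
    W.isClosed_topologicalClosure.completeSpace_coe
  obtain ⟨M, hM⟩ := banach_steinhaus
    (g := fun k => (innerSL ℝ (z k)).comp W.topologicalClosure.subtypeL) (by
      intro v
      obtain ⟨s, hs, hsv⟩ : ∃ s > (0 : ℝ), ‖s • (v : H)‖ < r := by
        refine ⟨r / (‖(v : H)‖ + 1), by positivity, ?_⟩
        rw [norm_smul, Real.norm_of_nonneg (by positivity), div_mul_eq_mul_div,
          div_lt_iff₀ (by positivity)]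
        nlinarith [norm_nonneg (v : H)]
      have hv := W.topologicalClosure.smul_mem s v.2
      obtain ⟨c, hc⟩ := h _ hv hsv
      obtain ⟨c', hc'⟩ := h _ (neg_mem hv) (by rwa [norm_neg])
      refine ⟨max c c' / s, fun k => ?_⟩
      have h1 := (hc k).trans (le_max_left c c')
      have h2 := (hc' k).trans (le_max_right c c')
      rw [inner_neg_right] at h2
      rw [real_inner_smul_right] at h1 h2
      simp only [ContinuousLinearMap.comp_apply, Submodule.subtypeL_apply, innerSL_apply_apply,
        Real.norm_eq_abs]
      rw [abs_le, le_div_iff₀ hs, ← neg_div, div_le_iff₀ hs]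
      constructor <;> linarith)
  refine ⟨M, fun k => ?_⟩
  -- Since `z k` itself lies in `W`, evaluating there recovers its norm from the restricted
  -- functional.
  have h1 := (ContinuousLinearMap.le_opNorm ((innerSL ℝ (z k)).comp W.topologicalClosure.subtypeL)
    ⟨z k, W.le_topologicalClosure (hz k)⟩).trans
      (mul_le_mul_of_nonneg_right (hM k) (norm_nonneg _))
  simp only [ContinuousLinearMap.comp_apply, Submodule.subtypeL_apply, innerSL_apply_apply,
    real_inner_self_eq_norm_sq, Submodule.coe_norm, norm_pow, norm_norm] at h1
  rcases (norm_nonneg (z k)).eq_or_lt with h0 | h0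
  · rw [← h0]
    exact (norm_nonneg _).trans (hM k)
  · nlinarith

/-- Bounded Tikhonov curves of a monotone mapping are convergent. -/
theorem cauchySeq_of_tikhonov {S : H → H} (hmono : ∀ x y, 0 ≤ inner ℝ (x - y) (S x - S y))
    {ε : ℕ → ℝ} (hpos : ∀ k, 0 < ε k) (hanti : StrictAnti ε) {z : ℕ → H} {d : H}
    (hz : ∀ k, S (z k) + ε k • z k = d) {M : ℝ} (hM : ∀ k, ‖z k‖ ≤ M) : CauchySeq z := by
  -- Monotonicity between `z l` and `z k` makes the norms increase as `ε` decreases, and bounds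
  -- squared distances by increments of squared norms.
  have key : ∀ k l, k < l → ‖z l - z k‖ ^ 2 ≤ ‖z l‖ ^ 2 - ‖z k‖ ^ 2 ∧ ‖z k‖ ^ 2 ≤ ‖z l‖ ^ 2 := by
    intro k l hkl
    have h1 := hmono (z l) (z k)
    have e : S (z l) - S (z k) = ε k • z k - ε l • z l := by
      rw [eq_sub_of_add_eq (hz k), eq_sub_of_add_eq (hz l)]
      abel
    rw [e] at h1
    simp only [inner_sub_left, inner_sub_right, real_inner_smul_right,
      real_inner_self_eq_norm_sq] at h1
    rw [real_inner_comm (z l) (z k)] at h1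
    have h2 := norm_sub_sq_real (z l) (z k)
    have h3 := sq_nonneg ‖z l - z k‖
    have h4 := hanti hkl
    have h5 := hpos l
    have h6 : ‖z k‖ ^ 2 ≤ ‖z l‖ ^ 2 := by
      have : 0 ≤ (ε k - ε l) * (‖z l‖ ^ 2 - ‖z k‖ ^ 2) := by nlinarith
      have := nonneg_of_mul_nonneg_right this (sub_pos.2 h4)
      linarith
    have h7 : 0 ≤ (ε k + ε l) * (inner ℝ (z l) (z k) - ‖z k‖ ^ 2) := by nlinarith
    have h8 := nonneg_of_mul_nonneg_right h7 (by linarith)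
    exact ⟨by linarith, h6⟩
  have hmon : Monotone fun k => ‖z k‖ ^ 2 :=
    monotone_nat_of_le_succ fun k => (key k (k + 1) k.lt_succ_self).2
  have hbdd : BddAbove (Set.range fun k => ‖z k‖ ^ 2) :=
    ⟨M ^ 2, by
      rintro _ ⟨k, rfl⟩
      exact pow_le_pow_left₀ (norm_nonneg _) (hM k) 2⟩
  have hcau := (tendsto_atTop_ciSup hmon hbdd).cauchySeq
  rw [Metric.cauchySeq_iff'] at hcau ⊢
  intro η hη
  obtain ⟨N, hN⟩ := hcau (η ^ 2) (by positivity)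
  refine ⟨N, fun l hl => ?_⟩
  rcases hl.eq_or_lt with rfl | hl'
  · simpa using hη
  · have h1 := hN l hl
    rw [Real.dist_eq] at h1
    have h2 := (key N l hl').1
    have h3 := (le_abs_self _).trans_lt h1
    rw [dist_eq_norm]
    exact lt_of_pow_lt_pow_left₀ 2 hη.le (h2.trans_lt h3)

/-- The Brezis–Haraux argument: if `S` is continuous and monotone, and `⟪S z - d, z⟫` is bounded
below in `z` for every `d ∈ D`, then the range of `S` is nearly equal to `D`. -/
theorem nearlyEqual_range [CompleteSpace H] {S : H → H} (hS : Continuous S)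
    (hmono : ∀ x y, 0 ≤ inner ℝ (x - y) (S x - S y)) {D : Set H} (hSD : Set.range S ⊆ D)
    (hD : ∀ d ∈ D, ∃ c, ∀ z, -c ≤ inner ℝ (S z - d) z) : NearlyEqual (Set.range S) D := by
  have hmax := isMaximallyMonotone_singleton hS hmono
  set ε : ℕ → ℝ := fun k => 1 / ((k : ℝ) + 1) with hε
  have hpos : ∀ k, 0 < ε k := fun k => by simp only [hε]; positivity
  have hanti : StrictAnti ε := fun k l hkl => Nat.one_div_lt_one_div hkl
  have hlim : Tendsto ε atTop (𝓝 0) := tendsto_one_div_add_atTop_nhds_zero_nat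
  have hsol : ∀ d, ∃ z : ℕ → H, ∀ k, S (z k) + ε k • z k = d := by
    intro d
    choose z hz using fun k => hmax.exists_sub_smul_mem (hpos k) d
    refine ⟨z, fun k => ?_⟩
    rw [← show d - ε k • z k = S (z k) from hz k, sub_add_cancel]
  refine nearlyEqual_of_subset hSD ?_ ?_
  · intro d hd
    obtain ⟨z, hz⟩ := hsol d
    obtain ⟨c, hc⟩ := hD d hd
    have hb : ∀ k, ‖ε k • z k‖ ≤ √(ε k * c) := by
      intro k
      apply Real.le_sqrt_of_sq_le
      have := hc (z k)
      rw [← hz k, sub_add_cancel_left, inner_neg_left, real_inner_smul_left,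
        real_inner_self_eq_norm_sq] at this
      rw [norm_smul, Real.norm_of_nonneg (hpos k).le, mul_pow, sq (ε k), mul_assoc]
      exact mul_le_mul_of_nonneg_left (by linarith) (hpos k).le
    have h0 : Tendsto (fun k => ε k • z k) atTop (𝓝 0) := by
      refine squeeze_zero_norm hb ?_
      simpa using (hlim.mul_const c).sqrt
    have h1 : Tendsto (fun k => S (z k)) atTop (𝓝 d) := by
      have := h0.const_sub d
      rw [sub_zero] at this
      exact this.congr fun k => by rw [← hz k, add_sub_cancel_right]
    exact mem_closure_of_tendsto h1 (Eventually.of_forall fun k => ⟨_, rfl⟩)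
  · intro d hd
    obtain ⟨hd, r, hr, hball⟩ := mem_relInterior_iff.1 hd
    have hdD : d ∈ D := hball d hd (by simpa using hr)
    obtain ⟨z, hz⟩ := hsol d
    -- `z k` is a multiple of `d - S (z k)`, a difference of two points of `D`.
    have hW : ∀ k, z k ∈ (affineSpan ℝ D).direction := by
      intro k
      have h1 : d - S (z k) ∈ (affineSpan ℝ D).direction :=
        AffineSubspace.vsub_mem_direction (subset_affineSpan ℝ D hdD)
          (subset_affineSpan ℝ D (hSD ⟨_, rfl⟩))
      rw [← hz k, add_sub_cancel_left] at h1
      simpa [smul_smul, (hpos k).ne'] using Submodule.smul_mem _ (ε k)⁻¹ h1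
    -- The lower bound for the target `d + v`, still in `D`, becomes an upper bound for `⟪z k, v⟫`.
    obtain ⟨M, hM⟩ := exists_norm_le_of_inner_le hW hr (by
      intro v hv hvr
      have hmem : d + v ∈ closure (affineSpan ℝ D : Set H) := by
        refine map_mem_closure (f := fun v => d + v) (by fun_prop) hv fun w hw => ?_
        change d + w ∈ _
        rw [add_comm]
        exact AffineSubspace.vadd_mem_of_mem_direction hw (subset_affineSpan ℝ D hdD)
      obtain ⟨c, hc⟩ := hD _ (hball _ hmem (by simpa using hvr))
      refine ⟨c, fun k => ?_⟩
      have h1 := hc (z k)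
      have e : S (z k) - (d + v) = -(ε k • z k) - v := by
        rw [← hz k]
        abel
      rw [e, inner_sub_left, inner_neg_left, real_inner_smul_left, real_inner_self_eq_norm_sq,
        real_inner_comm] at h1
      nlinarith [mul_nonneg (hpos k).le (sq_nonneg ‖z k‖)])
    obtain ⟨x, hx⟩ := cauchySeq_tendsto_of_complete
      (cauchySeq_of_tikhonov hmono hpos hanti hz hM)
    refine ⟨x, tendsto_nhds_unique ((hS.tendsto x).comp hx) ?_⟩
    have h1 : Tendsto (fun k => d - ε k • z k) atTop (𝓝 (d - (0 : ℝ) • x)) :=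
      (hlim.smul hx).const_sub d
    rw [zero_smul, sub_zero] at h1
    exact h1.congr fun k => by simp [← hz k]

/-- The range of a weighted sum of cocoercive mappings is nearly equal to the weighted sum of
their ranges. -/
theorem nearlyEqual_range_sum [CompleteSpace H] {ι : Type*} [Fintype ι] {T : ι → H → H}
    {w : ι → ℝ} (hw : ∀ i, 0 < w i) {β : ℝ} (hβ : 0 < β)
    (hT : ∀ i x y, β * ‖T i x - T i y‖ ^ 2 ≤ inner ℝ (T i x - T i y) (x - y)) :
    NearlyEqual (Set.range fun z => ∑ i, w i • T i z) (∑ i, w i • Set.range (T i)) := by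
  have hlip : ∀ i, Continuous (T i) := by
    intro i
    refine (LipschitzWith.of_dist_le_mul (K := (β⁻¹).toNNReal) fun x y => ?_).continuous
    rw [dist_eq_norm, dist_eq_norm, Real.coe_toNNReal _ (by positivity), inv_mul_eq_div,
      le_div_iff₀ hβ]
    have h1 := (hT i x y).trans (real_inner_le_norm _ _)
    rcases (norm_nonneg (T i x - T i y)).eq_or_lt with h0 | h0
    · rw [← h0, zero_mul]
      exact norm_nonneg _
    · nlinarith
  refine nearlyEqual_range (by fun_prop) ?_ ?_ ?_
  · intro x y
    rw [← Finset.sum_sub_distrib, inner_sum]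
    refine Finset.sum_nonneg fun i _ => ?_
    rw [← smul_sub, real_inner_smul_right, real_inner_comm]
    exact mul_nonneg (hw i).le (le_trans (by positivity) (hT i x y))
  · rintro _ ⟨z, rfl⟩
    exact (Set.mem_fintype_sum _ _).2 ⟨_, fun i => Set.smul_mem_smul_set ⟨z, rfl⟩, rfl⟩
  · intro d hd
    obtain ⟨g, hg, rfl⟩ := (Set.mem_fintype_sum _ _).1 hd
    choose y hy hyg using fun i => Set.mem_smul_set.1 (hg i)
    choose x hx using hy
    -- Young's inequality `a b ≤ β a² + b² / (4β)` absorbs the cross term into the cocoercivity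
    -- term.
    refine ⟨∑ i, w i * (‖x i‖ ^ 2 / (4 * β)), fun z => ?_⟩
    rw [← Finset.sum_sub_distrib, sum_inner, ← Finset.sum_neg_distrib]
    refine Finset.sum_le_sum fun i _ => ?_
    rw [← hyg i, ← hx i, ← smul_sub, real_inner_smul_left, ← mul_neg]
    refine mul_le_mul_of_nonneg_left ?_ (hw i).le
    have h1 := hT i z (x i)
    rw [inner_sub_right] at h1
    have h2 := neg_le_of_abs_le (abs_real_inner_le_norm (T i z - T i (x i)) (x i))
    have h3 : ‖T i z - T i (x i)‖ * ‖x i‖ ≤ β * ‖T i z - T i (x i)‖ ^ 2 + ‖x i‖ ^ 2 / (4 * β) := by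
      have : β * ‖T i z - T i (x i)‖ ^ 2 + ‖x i‖ ^ 2 / (4 * β) - ‖T i z - T i (x i)‖ * ‖x i‖
          = (2 * β * ‖T i z - T i (x i)‖ - ‖x i‖) ^ 2 / (4 * β) := by
        field_simp
        ring
      have h4 : 0 ≤ (2 * β * ‖T i z - T i (x i)‖ - ‖x i‖) ^ 2 / (4 * β) := by positivity
      linarith
    linarith

end BrezisHaraux

/-! ### Resolvents and the resolvent average -/

section Resolvent

variable {H : Type*}

theorem ran_inv (A : H → Set H) : ran (inv A) = dom A := by
  ext x
  simp [dom, ran, inv, Set.Nonempty]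

variable [NormedAddCommGroup H] [InnerProductSpace ℝ H]

/-- `T` is the single-valued mapping `(A + μ⁻¹ Id)⁻¹`. -/
def IsResolvent (μ : ℝ) (A : H → Set H) (T : H → H) : Prop :=
  ∀ x z, z - μ⁻¹ • x ∈ A x ↔ T z = x

theorem IsMaximallyMonotone.exists_isResolvent [CompleteSpace H] {A : H → Set H}
    (hA : IsMaximallyMonotone A) {μ : ℝ} (hμ : 0 < μ) : ∃ T, IsResolvent μ A T := by
  choose T hT using hA.exists_sub_smul_mem (inv_pos.2 hμ)
  refine ⟨T, fun x z => ⟨fun hx => ?_, fun h => h ▸ hT z⟩⟩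
  have h := hA.1.inner_nonneg (hT z) hx
  rw [sub_sub_sub_cancel_left, ← smul_sub, ← neg_sub (T z) x, smul_neg, inner_neg_right,
    real_inner_smul_right, real_inner_self_eq_norm_sq] at h
  have h1 : μ⁻¹ * ‖T z - x‖ ^ 2 = 0 :=
    le_antisymm (by linarith) (mul_nonneg (inv_pos.2 hμ).le (sq_nonneg _))
  simpa [hμ.ne', sub_eq_zero] using h1

namespace IsResolvent

variable {μ : ℝ} {A : H → Set H} {T : H → H}

theorem mem (hT : IsResolvent μ A T) (z : H) : z - μ⁻¹ • T z ∈ A (T z) := (hT _ _).2 rfl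

theorem eq_of_mem (hT : IsResolvent μ A T) {x u : H} (hu : u ∈ A x) : T (u + μ⁻¹ • x) = x :=
  (hT _ _).1 (by rwa [add_sub_cancel_right])

theorem inv_add_smul_idMap (hT : IsResolvent μ A T) (z : H) :
    inv (A + μ⁻¹ • idMap) z = {T z} := by
  ext x
  simp only [inv, idMap, Pi.add_apply, Pi.smul_apply, Set.smul_set_singleton,
    Set.add_singleton, Set.mem_ofPred_eq, Set.mem_singleton_iff, Set.mem_image]
  rw [eq_comm, ← hT]
  constructor
  · rintro ⟨u, hu, rfl⟩
    rwa [add_sub_cancel_right]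
  · exact fun h => ⟨_, h, sub_add_cancel _ _⟩

theorem range_eq_dom (hT : IsResolvent μ A T) : Set.range T = dom A := by
  ext x
  constructor
  · rintro ⟨z, rfl⟩
    exact ⟨_, hT.mem z⟩
  · rintro ⟨u, hu⟩
    exact ⟨_, hT.eq_of_mem hu⟩

theorem range_eq_ran (hT : IsResolvent μ A T) : Set.range (fun z => z - μ⁻¹ • T z) = ran A := by
  ext u
  simp only [ran, Set.mem_iUnion]
  constructor
  · rintro ⟨z, rfl⟩
    exact ⟨_, hT.mem z⟩
  · rintro ⟨x, hu⟩
    exact ⟨u + μ⁻¹ • x, by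
      simp only [hT.eq_of_mem hu, add_sub_cancel_right]⟩

theorem inv_mul_norm_sq_le (hT : IsResolvent μ A T) (hA : IsMonotone A) (x y : H) :
    μ⁻¹ * ‖T x - T y‖ ^ 2 ≤ inner ℝ (T x - T y) (x - y) := by
  have h := hA.inner_nonneg (hT.mem x) (hT.mem y)
  rw [sub_sub_sub_comm, ← smul_sub, inner_sub_right, real_inner_smul_right,
    real_inner_self_eq_norm_sq] at h
  linarith

/-- With `a = x - y`, `b = T x - T y` and `c = μ⁻¹`, the right side minus the left is `c (⟪b, a⟫ - c
‖b‖²)`. The factor `1` is the constant `β` of `nearlyEqual_range_sum`. -/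
theorem norm_sub_smul_sq_le (hT : IsResolvent μ A T) (hA : IsMonotone A) (hμ : 0 < μ) (x y : H) :
    1 * ‖(x - μ⁻¹ • T x) - (y - μ⁻¹ • T y)‖ ^ 2
      ≤ inner ℝ ((x - μ⁻¹ • T x) - (y - μ⁻¹ • T y)) (x - y) := by
  have h := mul_le_mul_of_nonneg_left (hT.inv_mul_norm_sq_le hA x y) (inv_pos.2 hμ).le
  rw [sub_sub_sub_comm, ← smul_sub]
  generalize T x - T y = b at h
  generalize x - y = a at h
  rw [norm_sub_sq_real, inner_sub_left, real_inner_smul_left, real_inner_smul_right,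
    real_inner_self_eq_norm_sq, norm_smul, real_inner_comm b a, mul_pow,
    Real.norm_of_nonneg (inv_pos.2 hμ).le]
  nlinarith

end IsResolvent

variable {n : ℕ} {μ : ℝ} {A : Fin n → H → Set H} {T : Fin n → H → H}

theorem resolventAverage_apply (hT : ∀ i, IsResolvent μ (A i) (T i)) (w : Fin n → ℝ) (x : H) :
    resolventAverage μ A w x = (fun z => z - μ⁻¹ • x) '' {z | ∑ i, w i • T i z = x} := by
  have h : ∀ z, (∑ i, w i • inv (A i + μ⁻¹ • idMap)) z = {∑ i, w i • T i z} := by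
    intro z
    rw [Finset.sum_apply]
    simp only [Pi.smul_apply, (hT _).inv_add_smul_idMap, Set.smul_set_singleton]
    ext y
    simp only [Set.mem_fintype_sum, Set.mem_singleton_iff]
    constructor
    · rintro ⟨g, hg, rfl⟩
      exact Finset.sum_congr rfl fun i _ => hg i
    · rintro rfl
      exact ⟨_, fun i => rfl, rfl⟩
  rw [resolventAverage, Pi.sub_apply, Pi.smul_apply, idMap, Set.smul_set_singleton,
    Set.sub_singleton]
  congr 1
  ext z
  simp only [inv, h, Set.mem_ofPred_eq, Set.mem_singleton_iff, eq_comm]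

theorem dom_resolventAverage (hT : ∀ i, IsResolvent μ (A i) (T i)) (w : Fin n → ℝ) :
    dom (resolventAverage μ A w) = Set.range fun z => ∑ i, w i • T i z := by
  ext x
  simp only [dom, resolventAverage_apply hT, Set.image_nonempty, Set.mem_ofPred_eq]
  rfl

/-- Weights of sum one let the identity be distributed over the terms of the average. -/
theorem ran_resolventAverage (hT : ∀ i, IsResolvent μ (A i) (T i)) {w : Fin n → ℝ}
    (hw : ∑ i, w i = 1) :
    ran (resolventAverage μ A w) = Set.range fun z => ∑ i, w i • (z - μ⁻¹ • T i z) := by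
  have h : ∀ z, ∑ i, w i • (z - μ⁻¹ • T i z) = z - μ⁻¹ • ∑ i, w i • T i z := by
    intro z
    simp only [smul_sub, Finset.sum_sub_distrib, ← Finset.sum_smul, hw, one_smul, Finset.smul_sum,
      smul_comm μ⁻¹]
  ext u
  simp only [ran, resolventAverage_apply hT, Set.mem_iUnion, h]
  constructor
  · rintro ⟨_, z, rfl, rfl⟩
    exact ⟨z, rfl⟩
  · rintro ⟨z, rfl⟩
    exact ⟨_, z, rfl, rfl⟩

/-- The ranges of the resolvent average and of the weighted sum are nearly equal, and so are the
domains. -/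
theorem nearlyEqual_resolventAverage [CompleteSpace H] {w : Fin n → ℝ} (hμ : 0 < μ)
    (hw : ∀ i, 0 < w i) (hsum : ∑ i, w i = 1) (hA : ∀ i, IsMaximallyMonotone (A i)) :
    NearlyEqual (ran (resolventAverage μ A w)) (∑ i, w i • ran (A i)) ∧
      NearlyEqual (dom (resolventAverage μ A w)) (∑ i, w i • dom (A i)) := by
  choose T hT using fun i => (hA i).exists_isResolvent hμ
  rw [ran_resolventAverage hT hsum, dom_resolventAverage hT]
  simp only [← (hT _).range_eq_ran, ← (hT _).range_eq_dom]
  exact ⟨nearlyEqual_range_sum hw one_pos fun i => (hT i).norm_sub_smul_sq_le (hA i).1 hμ,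
    nearlyEqual_range_sum hw (inv_pos.2 hμ) fun i => (hT i).inv_mul_norm_sq_le (hA i).1⟩

theorem dom_resolventAverage_self [CompleteSpace H] {A : H → Set H} (hA : IsMaximallyMonotone A)
    (hμ : 0 < μ) {w : Fin n → ℝ} (hsum : ∑ i, w i = 1) :
    dom (resolventAverage μ (fun _ => A) w) = dom A := by
  obtain ⟨T, hT⟩ := hA.exists_isResolvent hμ
  rw [dom_resolventAverage (fun _ => hT), ← hT.range_eq_dom]
  simp only [← Finset.sum_smul, hsum, one_smul]

theorem ran_resolventAverage_self [CompleteSpace H] {A : H → Set H} (hA : IsMaximallyMonotone A)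
    (hμ : 0 < μ) {w : Fin n → ℝ} (hsum : ∑ i, w i = 1) :
    ran (resolventAverage μ (fun _ => A) w) = ran A := by
  obtain ⟨T, hT⟩ := hA.exists_isResolvent hμ
  rw [ran_resolventAverage (fun _ => hT) hsum, ← hT.range_eq_ran]
  simp only [← Finset.sum_smul, hsum, one_smul]

end Resolvent

/-! ### Subdifferentials of convex functions -/

section Subdifferential

variable {K : Type*} [NormedAddCommGroup K] [InnerProductSpace ℝ K]

/-- The subdifferential of the function with epigraph `E`. -/
def subdifferential (E : Set (K × ℝ)) : K → Set K := fun x =>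
  {u | ∃ t, (x, t) ∈ E ∧ ∀ q ∈ E, t + inner ℝ u (q.1 - x) ≤ q.2}

theorem isMonotone_subdifferential (E : Set (K × ℝ)) : IsMonotone (subdifferential E) := by
  rintro ⟨x, u⟩ ⟨t, hx, hu⟩ ⟨y, v⟩ ⟨s, hy, hv⟩
  have h1 := hu _ hy
  have h2 := hv _ hx
  dsimp only at *
  rw [← neg_sub, inner_neg_right] at h1
  rw [real_inner_comm, inner_sub_left]
  linarith

theorem isMaximallyMonotone_subdifferential [CompleteSpace K] {E : Set (K × ℝ)}
    (hconv : Convex ℝ E) (hclosed : IsClosed E) (hne : E.Nonempty) {c : ℝ}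
    (hc : ∀ p ∈ E, c ≤ p.2) : IsMaximallyMonotone (subdifferential E) := by
  refine isMaximallyMonotone_of_surjective (isMonotone_subdifferential E) fun z => ?_
  obtain ⟨p, hp, h⟩ := exists_proximal_point hconv hclosed hne z (c := c) fun p hp =>
    (hc p hp).trans (le_add_of_nonneg_right (by positivity))
  exact ⟨p.1, p.2, hp, h⟩

end Subdifferential

/-! ### A subdifferential with nonconvex domain -/

section Plane

/-- The epigraph of `(x, y) ↦ max (1 - √x) |y|` on the half-plane `0 ≤ x`. -/
def sqrtEpigraph : Set (EuclideanSpace ℝ (Fin 2) × ℝ) :=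
  {p | 0 ≤ p.1 0 ∧ |p.1 1| ≤ p.2 ∧ 1 - √(p.1 0) ≤ p.2}

theorem isMaximallyMonotone_subdifferential_sqrtEpigraph :
    IsMaximallyMonotone (subdifferential sqrtEpigraph) := by
  refine isMaximallyMonotone_subdifferential (c := 0) ?_ ?_ ⟨(0, 1), ?_⟩ ?_
  · rintro p ⟨hp1, hp2, hp3⟩ q ⟨hq1, hq2, hq3⟩ a b ha hb hab
    have h := Real.strictConcaveOn_sqrt.concaveOn.2 (Set.mem_Ici.2 hp1) (Set.mem_Ici.2 hq1)
      ha hb hab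
    simp only [smul_eq_mul] at h
    simp only [sqrtEpigraph, Set.mem_ofPred_eq, Prod.fst_add, Prod.smul_fst, Prod.snd_add,
      Prod.smul_snd, PiLp.add_apply, PiLp.smul_apply, smul_eq_mul]
    refine ⟨by positivity, ?_, ?_⟩
    · refine (abs_add_le _ _).trans ?_
      rw [abs_mul, abs_mul, abs_of_nonneg ha, abs_of_nonneg hb]
      gcongr
    · have h1 := mul_le_mul_of_nonneg_left hp3 ha
      have h2 := mul_le_mul_of_nonneg_left hq3 hb
      linarith
  · simp only [sqrtEpigraph, Set.ofPred_and]
    refine (isClosed_le ?_ ?_).inter ((isClosed_le ?_ ?_).inter (isClosed_le ?_ ?_)) <;> fun_prop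
  · simp [sqrtEpigraph]
  · exact fun p hp => (abs_nonneg _).trans hp.2.1

/-- At these points `|y|` attains the maximum, so its subgradient `(0, s)` serves. -/
theorem mem_dom_of_abs_eq_one {s : ℝ} (hs : |s| = 1) :
    !₂[0, s] ∈ dom (subdifferential sqrtEpigraph) := by
  refine ⟨!₂[0, s], 1, by simp [sqrtEpigraph, hs], fun q hq => ?_⟩
  have h : s * q.1 1 ≤ |q.1 1| := by
    refine (le_abs_self _).trans ?_
    rw [abs_mul, hs, one_mul]
  have h2 : s * s = 1 := by rw [← abs_mul_abs_self, hs, one_mul]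
  have h3 := hq.2.1
  simp [PiLp.inner_apply, Fin.sum_univ_two]
  nlinarith

/-- Here `1 - √x` dominates and has slope `-∞` at `x = 0`: moving to `x = ε ^ 2` lowers the function
by `ε`, while a subgradient `u` allows a drop of at most `ε ^ 2 * |u 0|`. -/
theorem notMem_dom_of_abs_lt_one {s : ℝ} (hs : |s| < 1) :
    !₂[0, s] ∉ dom (subdifferential sqrtEpigraph) := by
  rintro ⟨u, t, ht, hu⟩
  have ht1 : 1 ≤ t := by simpa [sqrtEpigraph] using ht.2.2
  obtain ⟨ε, hε, hεs, hεu⟩ : ∃ ε > 0, ε ≤ 1 - |s| ∧ ε * |u 0| < 1 := by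
    refine ⟨min (1 - |s|) (1 / (|u 0| + 1)), lt_min (by linarith) (by positivity),
      min_le_left _ _, ?_⟩
    calc _ ≤ 1 / (|u 0| + 1) * |u 0| := by gcongr; exact min_le_right _ _
      _ < 1 := by
        rw [one_div_mul_eq_div, div_lt_one (by positivity)]
        linarith
  have h := hu (!₂[ε ^ 2, s], 1 - ε) ⟨by simp; positivity, by simp; linarith,
    by simp [Real.sqrt_sq hε.le]⟩
  simp [PiLp.inner_apply, Fin.sum_univ_two] at h
  have h1 := neg_abs_le (u 0)
  nlinarith

theorem dom_ne_smul_dom_add_smul_dom {t : ℝ} (h0 : 0 < t) (h1 : t < 1) :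
    dom (subdifferential sqrtEpigraph) ≠
      t • dom (subdifferential sqrtEpigraph) + (1 - t) • dom (subdifferential sqrtEpigraph) := by
  intro h
  -- `2 * t - 1` is the combination of `1` and `-1` with weights `t` and `1 - t`.
  refine notMem_dom_of_abs_lt_one (s := 2 * t - 1) (by rw [abs_lt]; constructor <;> linarith) ?_
  rw [h]
  refine ⟨_, Set.smul_mem_smul_set (mem_dom_of_abs_eq_one (s := 1) (by simp)), _,
    Set.smul_mem_smul_set (mem_dom_of_abs_eq_one (s := -1) (by simp)), ?_⟩
  ext i
  fin_cases i <;> simp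
  ring

end Plane

end ResolventAverage

theorem theorem2p10 :
    -- the two near equalities
    (∀ (H : Type*) [NormedAddCommGroup H] [InnerProductSpace ℝ H] [CompleteSpace H]
        (n : ℕ) (μ : ℝ) (w : Fin n → ℝ) (A : Fin n → H → Set H),
        0 < μ → (∀ i, 0 < w i) → ∑ i, w i = 1 →
        (∀ i, ResolventAverage.IsMaximallyMonotone (A i)) →
        ResolventAverage.NearlyEqual
            (ResolventAverage.ran (ResolventAverage.resolventAverage μ A w))
            (∑ i, w i • ResolventAverage.ran (A i)) ∧
          ResolventAverage.NearlyEqual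
            (ResolventAverage.dom (ResolventAverage.resolventAverage μ A w))
            (∑ i, w i • ResolventAverage.dom (A i))) ∧
    -- equality of the domains can fail, even in the plane and for two equal mappings
    (∃ A : EuclideanSpace ℝ (Fin 2) → Set (EuclideanSpace ℝ (Fin 2)),
        ResolventAverage.IsMaximallyMonotone A ∧
        ∀ t : ℝ, 0 < t → t < 1 →
          ResolventAverage.dom
              (ResolventAverage.resolventAverage 1 (fun _ : Fin 2 => A) ![t, 1 - t]) ≠
            t • ResolventAverage.dom A + (1 - t) • ResolventAverage.dom A) ∧
    -- equality of the ranges can fail, even in the plane and for two equal mappings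
    (∃ A : EuclideanSpace ℝ (Fin 2) → Set (EuclideanSpace ℝ (Fin 2)),
        ResolventAverage.IsMaximallyMonotone A ∧
        ∀ t : ℝ, 0 < t → t < 1 →
          ResolventAverage.ran
              (ResolventAverage.resolventAverage 1 (fun _ : Fin 2 => A) ![t, 1 - t]) ≠
            t • ResolventAverage.ran A + (1 - t) • ResolventAverage.ran A) := by
  have hsum : ∀ t : ℝ, ∑ i, ![t, 1 - t] i = 1 := fun t => by simp
  refine ⟨fun H _ _ _ n μ w A hμ hw hs hA =>
    ResolventAverage.nearlyEqual_resolventAverage hμ hw hs hA, ?_, ?_⟩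
  · refine ⟨_, ResolventAverage.isMaximallyMonotone_subdifferential_sqrtEpigraph,
      fun t h0 h1 => ?_⟩
    rw [ResolventAverage.dom_resolventAverage_self
      ResolventAverage.isMaximallyMonotone_subdifferential_sqrtEpigraph one_pos (hsum t)]
    exact ResolventAverage.dom_ne_smul_dom_add_smul_dom h0 h1
  · refine ⟨_, ResolventAverage.isMaximallyMonotone_subdifferential_sqrtEpigraph.inv,
      fun t h0 h1 => ?_⟩
    rw [ResolventAverage.ran_resolventAverage_self
      ResolventAverage.isMaximallyMonotone_subdifferential_sqrtEpigraph.inv one_pos (hsum t),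
      ResolventAverage.ran_inv]
    exact ResolventAverage.dom_ne_smul_dom_add_smul_dom h0 h1
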